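/- Let $\xi=(\xi_1,\xi_2,\ldots)$ be a swap-invariant sequence of integrable real random variables on a probability space; that is, for all indices $k_1<\dots<k_d$, all $u\in\mathbb R^d$ and all permutations $\sigma$ of $\{1,\dots,d\}$, $$\mathbb E\Bigl|\sum_{i=1}^d u_i\,\xi_{k_i}\Bigr|=\mathbb E\Bigl|\sum_{i=1}^d u_i\,\xi_{k_{\sigma(i)}}\Bigr| .$$ ($\xi$ is not assumed to be symmetric.) Suppose that $\xi_1\neq0$ a.s. Let $\varepsilon$ be a Rademacher random variable on the same probability space, $\mathbb P(\varepsilon=1)=\mathbb P(\varepsilon=-1)=\tfrac12$, independent of the sequence $\xi$. Put $\varepsilon\tilde\xi=(\varepsilon\xi_2/|\xi_1|,\varepsilon\xi_3/|\xi_1|,\ldots)$ and let $\mathcal E_{\varepsilon\tilde\xi}$ be its permutation-invariant $\sigma$-field, i.e. the $\sigma$-field of all events $\{\varepsilon\tilde\xi\in B\}$, where $B$ is a Borel subset of $\mathbb R^{\mathbb N}$ that is invariant under all permutations of finitely many coordinates. Then $\mathbb E(|\xi_1|\mid\mathcal E_{\varepsilon\tilde\xi})>0$ a.s., the random variable $$X=\frac{|\xi_1|}{\mathbb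 E(|\xi_1|\mid\mathcal E_{\varepsilon\tilde\xi})\,\varepsilon}\;\mathbb E(\varepsilon\xi_2\mid\mathcal E_{\varepsilon\tilde\xi})$$ is integrable, and $$\frac1n\sum_{i=1}^n\xi_i\longrightarrow X\qquad\text{a.s. and in }L^1\text{ as }n\to\infty .$$ -/

import Mathlib

open MeasureTheory ProbabilityTheory Filter Topology
open scoped ENNReal

noncomputable section

/-- Two integrable random vectors in `ℝ^d` (possibly on different probability spaces) are zonoid
equivalent if `E|⟨u, X⟩| = E|⟨u, Y⟩|` for every `u`. -/
def ZonoidEquivalent {Ω Ω' : Type*} [MeasurableSpace Ω] [MeasurableSpace Ω'] {d : ℕ}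
    (μ : Measure Ω) (ν : Measure Ω') (X : Ω → Fin d → ℝ) (Y : Ω' → Fin d → ℝ) : Prop :=
  Integrable X μ ∧ Integrable Y ν ∧
    ∀ u : Fin d → ℝ, ∫ ω, |∑ i, u i * X ω i| ∂μ = ∫ ω, |∑ i, u i * Y ω i| ∂ν

/-- An integrable random vector is swap-invariant if all vectors obtained by permuting its
coordinates are zonoid equivalent. -/
def SwapInvariantVector {Ω : Type*} [MeasurableSpace Ω] {d : ℕ}
    (μ : Measure Ω) (X : Ω → Fin d → ℝ) : Prop :=
  Integrable X μ ∧
    ∀ σ τ : Equiv.Perm (Fin d),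
      ZonoidEquivalent μ μ (fun ω i => X ω (σ i)) (fun ω i => X ω (τ i))

/-- A sequence of integrable random variables is swap-invariant if all its finite subsequences
are swap-invariant. -/
def SwapInvariant {Ω : Type*} [MeasurableSpace Ω] (μ : Measure Ω) (ξ : ℕ → Ω → ℝ) : Prop :=
  (∀ n, Integrable (ξ n) μ) ∧
    ∀ (d : ℕ) (k : Fin d → ℕ), StrictMono k → SwapInvariantVector μ (fun ω i => ξ (k i) ω)

/-- The σ-field on `ℝ^ℕ` of the Borel sets that are invariant under all finite permutations of
the coordinates. -/
@[reducible] def permInvariantSets : MeasurableSpace (ℕ → ℝ) where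
  MeasurableSet' B := MeasurableSet B ∧
    ∀ π : Equiv.Perm ℕ, {i | π i ≠ i}.Finite → (fun (x : ℕ → ℝ) i => x (π i)) ⁻¹' B = B
  measurableSet_empty := ⟨MeasurableSet.empty, fun _ _ => rfl⟩
  measurableSet_compl B hB :=
    ⟨hB.1.compl, fun π hπ => by rw [Set.preimage_compl, hB.2 π hπ]⟩
  measurableSet_iUnion f hf :=
    ⟨MeasurableSet.iUnion fun n => (hf n).1, fun π hπ => by
      rw [Set.preimage_iUnion]
      exact Set.iUnion_congr fun n => (hf n).2 π hπ⟩

/-- The permutation-invariant σ-field `E_X` of a random sequence `X`: the events `{X ∈ B}` with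
`B` a permutation-invariant Borel subset of `ℝ^ℕ`. -/
@[reducible] def permInvariantField {Ω : Type*} (X : Ω → ℕ → ℝ) : MeasurableSpace Ω :=
  permInvariantSets.comap X

/-- `E_X` is a sub-σ-field of the ambient one, so conditioning on it is meaningful. -/
theorem permInvariantField_le {Ω : Type*} [m : MeasurableSpace Ω] {X : Ω → ℕ → ℝ}
    (hX : Measurable X) : permInvariantField X ≤ m := by
  rintro _ ⟨B, hB, rfl⟩
  exact hX hB.1

/-- `ε` is a Rademacher variable: it takes the values `1` and `-1` with probability `1/2` each. -/
def IsRademacher {Ω : Type*} [MeasurableSpace Ω] (μ : Measure Ω) (ε : Ω → ℝ) : Prop :=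
  Measurable ε ∧ μ {ω | ε ω = 1} = 1 / 2 ∧ μ {ω | ε ω = -1} = 1 / 2

/-- The sequence `ε ξ̃ = (ε ξ₂ / |ξ₁|, ε ξ₃ / |ξ₁|, …)`; the entry `ξ₁` is `ξ 0` in the code,
since sequences are indexed from `0` there. -/
def signedRatios {Ω : Type*} (ξ : ℕ → Ω → ℝ) (ε : Ω → ℝ) : Ω → ℕ → ℝ :=
  fun ω n => ε ω * (ξ (n + 1) ω / |ξ 0 ω|)

/-- The average `n⁻¹ (ξ₁ + ⋯ + ξₙ)`. -/
def seqAverage {Ω : Type*} (ξ : ℕ → Ω → ℝ) (n : ℕ) : Ω → ℝ :=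
  fun ω => (n : ℝ)⁻¹ * ∑ i ∈ Finset.range n, ξ i ω

/-- The random variable `|ξ₁| E(ε ξ₂ | E_{ε ξ̃}) / (E(|ξ₁| | E_{ε ξ̃}) ε)`. -/
def ergodicLimit {Ω : Type*} [MeasurableSpace Ω] (μ : Measure Ω) (ξ : ℕ → Ω → ℝ) (ε : Ω → ℝ) :
    Ω → ℝ :=
  fun ω =>
    |ξ 0 ω| / ((μ[fun ω' => |ξ 0 ω'| | permInvariantField (signedRatios ξ ε)]) ω * ε ω) *
      (μ[fun ω' => ε ω' * ξ 1 ω' | permInvariantField (signedRatios ξ ε)]) ω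

end

/-! Reweight `μ` by `|ξ 0|`. For a permutation fixing the index 0, swap invariance says that `E|a ξ
0 + ∑ u i ξ (i+1)|` does not change when the later entries are permuted. Dividing by `ξ 0`, this is
an identity between the integrals of `|a + ∑ u i R i|` under the new measure, with `R i = ξ (i+1) /
ξ 0`. The functions `x ↦ |a + x|` together with the mass determine a finite law on the line, so
Cramér–Wold makes `R` exchangeable (`SwapInvariant.exchangeableMeasure_map_ratio`). As `ε` is
independent of `ξ`, the sequence `ε ξ̃` has the equal mixture of the laws of `R` and `-R`, and is
exchangeable as well. The strong law for exchangeable sequences, proved with backward martingales,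
gives the limit of its averages as a conditional expectation under the new measure. Bayes' formula
(`condExp_permInvariantField_eq_mul_condExp`) turns this into a quotient of conditional expectations
under `μ`; multiplication by `ε |ξ 0|` recovers the averages of `ξ`. Both modes of convergence
return to `μ`: null sets because `ξ 0 ≠ 0` a.e., and `L¹` norms because the density is exactly `|ξ
0|`. -/

/-! ### Lévy's downward theorem. -/

section BackwardMartingale

variable {Ω : Type*} {m0 : MeasurableSpace Ω} {μ : Measure Ω} {E : ℕ → MeasurableSpace Ω}

/-- A function that is a.e.-measurable for each σ-field of a decreasing sequence is
a.e.-measurable for their intersection. -/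
theorem aestronglyMeasurable_iInf_of_antitone (hE : Antitone E) {f : Ω → ℝ}
    (hf : ∀ n, AEStronglyMeasurable[E n] f μ) : AEStronglyMeasurable[⨅ n, E n] f μ := by
  choose g hg hfg using hf
  refine ⟨fun ω => limsup (fun n => g n ω) atTop, ?_, ?_⟩
  · refine Measurable.stronglyMeasurable ?_
    intro s hs
    rw [MeasurableSpace.measurableSet_iInf]
    intro k
    -- A limsup ignores its first `k` terms, and all later ones are `E k`-measurable.
    have hk : Measurable[E k] fun ω => limsup (fun n => g (n + k) ω) atTop :=
      Measurable.limsup fun n =>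
        ((hg (n + k)).measurable.mono (hE (Nat.le_add_left k n)) le_rfl)
    have : (fun ω => limsup (fun n => g (n + k) ω) atTop)
        = fun ω => limsup (fun n => g n ω) atTop := by
      funext ω
      exact limsup_nat_add (fun n => g n ω) k
    rw [this] at hk
    exact hk hs
  · filter_upwards [ae_all_iff.2 hfg] with ω hω
    simp only [← hω]
    simp

/-- In `L²` these are orthogonal projections onto decreasing subspaces. Their complements increase,
so the projections onto them converge to the projection onto the closure of the union; subtracting
from the identity returns to the original subspaces. -/
theorem tendsto_eLpNorm_condExp_iInf_of_memLp_two [IsFiniteMeasure μ] (hE : Antitone E)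
    (hle : ∀ n, E n ≤ m0) {f : Ω → ℝ} (hf : MemLp f 2 μ) :
    Tendsto (fun n => eLpNorm (μ[f | E n] - μ[f | ⨅ n, E n]) 1 μ) atTop (𝓝 0) := by
  have hle' : (⨅ n, E n) ≤ m0 := (iInf_le E 0).trans (hle 0)
  have : ∀ n, Fact (E n ≤ m0) := fun n => ⟨hle n⟩
  have : Fact ((⨅ n, E n) ≤ m0) := ⟨hle'⟩
  let U : ℕ → Submodule ℝ (Ω →₂[μ] ℝ) := fun n => lpMeas ℝ ℝ (E n) 2 μ
  have : ∀ n, (U n).HasOrthogonalProjection := fun n => by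
    change (lpMeas ℝ ℝ (E n) 2 μ).HasOrthogonalProjection
    infer_instance
  have hU : ⨅ n, U n = lpMeas ℝ ℝ (⨅ n, E n) 2 μ := by
    ext g
    simp only [Submodule.mem_iInf, U, mem_lpMeas_iff_aestronglyMeasurable]
    refine ⟨aestronglyMeasurable_iInf_of_antitone hE, fun h n => ?_⟩
    exact h.mono (iInf_le E n)
  have hmono : Monotone fun n => (U n)ᗮ := by
    intro i j hij
    refine Submodule.orthogonal_le fun g hg => ?_
    simp only [U, mem_lpMeas_iff_aestronglyMeasurable] at hg ⊢
    exact hg.mono (hE hij)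
  have hsup : (⨆ n, (U n)ᗮ).topologicalClosure = (lpMeas ℝ ℝ (⨅ n, E n) 2 μ)ᗮ := by
    rw [← Submodule.orthogonal_orthogonal_eq_closure, ← Submodule.iInf_orthogonal, ← hU]
    congr 2
    funext n
    rw [Submodule.orthogonal_orthogonal]
  have key := Submodule.starProjection_tendsto_closure_iSup (fun n => (U n)ᗮ) hmono (hf.toLp f)
  have key2 : Tendsto (fun n => (U n).starProjection (hf.toLp f)) atTop
      (𝓝 ((lpMeas ℝ ℝ (⨅ n, E n) 2 μ).starProjection (hf.toLp f))) := by
    simp only [hsup, Submodule.starProjection_orthogonal_val] at key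
    simpa using (tendsto_const_nhds (x := hf.toLp f)).sub key
  rw [Lp.tendsto_Lp_iff_tendsto_eLpNorm'] at key2
  have h2 : Tendsto (fun n => eLpNorm (μ[f | E n] - μ[f | ⨅ n, E n]) 2 μ) atTop (𝓝 0) := by
    refine key2.congr fun n => eLpNorm_congr_ae ?_
    exact (hf.condExpL2_ae_eq_condExp (𝕜 := ℝ) (hle n)).sub
      (hf.condExpL2_ae_eq_condExp (𝕜 := ℝ) hle')
  have hbound : ∀ n, eLpNorm (μ[f | E n] - μ[f | ⨅ n, E n]) 1 μ
      ≤ eLpNorm (μ[f | E n] - μ[f | ⨅ n, E n]) 2 μ * μ Set.univ ^ (1 / 2 : ℝ) := by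
    intro n
    convert eLpNorm_le_eLpNorm_mul_rpow_measure_univ (μ := μ) (p := 1) (q := 2) one_le_two
      (f := μ[f | E n] - μ[f | ⨅ n, E n])
      (integrable_condExp.sub integrable_condExp).aestronglyMeasurable using 3
    norm_num
  refine tendsto_of_tendsto_of_tendsto_of_le_of_le tendsto_const_nhds ?_ (fun _ => zero_le) hbound
  have := ENNReal.Tendsto.mul_const (b := μ Set.univ ^ (1 / 2 : ℝ)) h2
    (Or.inr (ENNReal.rpow_ne_top_of_nonneg (by norm_num) (measure_ne_top μ _)))
  simpa using this

/-- Lévy's downward theorem, `L¹` convergence. -/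
theorem tendsto_eLpNorm_condExp_iInf [IsFiniteMeasure μ] (hE : Antitone E)
    (hle : ∀ n, E n ≤ m0) {f : Ω → ℝ} (hf : Integrable f μ) :
    Tendsto (fun n => eLpNorm (μ[f | E n] - μ[f | ⨅ n, E n]) 1 μ) atTop (𝓝 0) := by
  rw [ENNReal.tendsto_nhds_zero]
  intro δ hδ
  have hδ3 : δ / 3 ≠ 0 := by simpa using hδ.ne'
  obtain ⟨g, hg, hg2⟩ : ∃ g : Ω → ℝ, eLpNorm (f - g) 1 μ < δ / 3 ∧ MemLp g 2 μ := by
    obtain ⟨g, hg, -⟩ := (memLp_one_iff_integrable.2 hf).exists_simpleFunc_eLpNorm_sub_lt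
      (by simp) hδ3
    exact ⟨g, hg, SimpleFunc.memLp_of_isFiniteMeasure g 2 μ⟩
  have hgi : Integrable g μ := hg2.integrable one_le_two
  have hclose : ∀ m : MeasurableSpace Ω, eLpNorm (μ[f | m] - μ[g | m]) 1 μ ≤ δ / 3 := fun m =>
    calc eLpNorm (μ[f | m] - μ[g | m]) 1 μ = eLpNorm (μ[f - g | m]) 1 μ :=
          eLpNorm_congr_ae (condExp_sub hf hgi m).symm
      _ ≤ eLpNorm (f - g) 1 μ := eLpNorm_condExp_le_eLpNorm _ le_rfl
      _ ≤ δ / 3 := hg.le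
  have hev := (ENNReal.tendsto_nhds_zero.1
    (tendsto_eLpNorm_condExp_iInf_of_memLp_two hE hle hg2)) (δ / 3) (pos_iff_ne_zero.2 hδ3)
  filter_upwards [hev] with n hn
  have hdecomp : μ[f | E n] - μ[f | ⨅ n, E n] = (μ[f | E n] - μ[g | E n])
      + ((μ[g | E n] - μ[g | ⨅ n, E n]) - (μ[f | ⨅ n, E n] - μ[g | ⨅ n, E n])) := by abel
  have hmeas : ∀ (m m' : MeasurableSpace Ω) (h h' : Ω → ℝ),
      AEStronglyMeasurable[m0] (μ[h | m] - μ[h' | m']) μ := fun m m' h h' =>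
    (integrable_condExp.sub integrable_condExp).aestronglyMeasurable
  calc eLpNorm (μ[f | E n] - μ[f | ⨅ n, E n]) 1 μ
      ≤ δ / 3 + (δ / 3 + δ / 3) := by
        rw [hdecomp]
        refine (eLpNorm_add_le (hmeas _ _ _ _)
          ((hmeas _ _ _ _).sub (hmeas _ _ _ _)) le_rfl).trans ?_
        gcongr
        · exact hclose _
        · refine (eLpNorm_sub_le (hmeas _ _ _ _) (hmeas _ _ _ _) le_rfl).trans ?_
          gcongr
          exact hclose _
    _ = δ := by rw [← add_assoc, ENNReal.add_thirds]

/-- The σ-fields `E k, E (k - 1), …, E 0, E 0, …` form a filtration when `E` is decreasing. -/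
def reversedFiltration (hE : Antitone E) (hle : ∀ n, E n ≤ m0) (k : ℕ) : Filtration ℕ m0 where
  seq i := E (k - i)
  mono' _ _ hij := hE (Nat.sub_le_sub_left hij k)
  le' _ := hle _

/-- Doob's maximal inequality for a backward martingale. -/
theorem mul_measure_exists_le_abs_condExp_le [IsFiniteMeasure μ] (hE : Antitone E)
    (hle : ∀ n, E n ≤ m0) (f : Ω → ℝ) (c : NNReal) (m : ℕ) :
    c * μ {ω | ∃ n, m ≤ n ∧ (c : ℝ) ≤ |(μ[f | E n]) ω|} ≤ eLpNorm (μ[f | E m]) 1 μ := by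
  have hfin : ∀ N, c * μ {ω | ∃ i ≤ N, (c : ℝ) ≤ |(μ[f | E (m + i)]) ω|}
      ≤ eLpNorm (μ[f | E m]) 1 μ := by
    intro N
    have hE' : Antitone fun i => E (m + i) := fun i j hij => hE (Nat.add_le_add_left hij m)
    have hmart := martingale_condExp f (reversedFiltration hE' (fun i => hle (m + i)) N) μ
    -- The supremum of the martingale and its negative is its modulus.
    have hsub := hmart.submartingale.sup hmart.neg.submartingale
    have hmax := maximal_ineq (ε := c) hsub (fun i ω => by
      exact abs_nonneg ((μ[f | (reversedFiltration hE' (fun i => hle (m + i)) N) i]) ω)) N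
    refine (le_trans ?_ hmax).trans ?_
    · gcongr
      rename_i ω
      rintro ⟨i, hi, hc⟩
      simp only [Finset.le_sup'_iff, Finset.mem_range]
      -- Time runs backwards: `E (m + i)` sits at index `N - i`.
      refine ⟨N - i, by omega, ?_⟩
      simpa [reversedFiltration, Nat.sub_sub_self hi, abs] using hc
    · have habs : ((fun i => μ[f | (reversedFiltration hE' (fun i => hle (m + i)) N) i]) ⊔
          -(fun i => μ[f | (reversedFiltration hE' (fun i => hle (m + i)) N) i])) N
          = fun ω => ‖(μ[f | E m]) ω‖ := by
        funext ω
        simp [reversedFiltration, abs]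
      rw [habs, eLpNorm_one_eq_lintegral_enorm,
        ← ofReal_integral_norm_eq_lintegral_enorm integrable_condExp]
      exact ENNReal.ofReal_le_ofReal (setIntegral_le_integral integrable_condExp.norm
        (ae_of_all _ fun _ => norm_nonneg _))
  have hunion : {ω | ∃ n, m ≤ n ∧ (c : ℝ) ≤ |(μ[f | E n]) ω|}
      = ⋃ N, {ω | ∃ i ≤ N, (c : ℝ) ≤ |(μ[f | E (m + i)]) ω|} := by
    ext ω
    simp only [Set.mem_ofPred_eq, Set.mem_iUnion]
    constructor
    · rintro ⟨n, hn, h⟩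
      obtain ⟨i, rfl⟩ := Nat.exists_eq_add_of_le hn
      exact ⟨i, i, le_rfl, h⟩
    · rintro ⟨N, i, -, h⟩
      exact ⟨m + i, Nat.le_add_right _ _, h⟩
  have hmono : Monotone fun N => {ω | ∃ i ≤ N, (c : ℝ) ≤ |(μ[f | E (m + i)]) ω|} := by
    rintro N N' hN ω ⟨i, hi, h⟩
    exact ⟨i, hi.trans hN, h⟩
  rw [hunion, hmono.measure_iUnion, ENNReal.mul_iSup]
  exact iSup_le hfin

/-- If the moduli exceed `c` infinitely often, they do so after every time `m`; the maximal
inequality bounds that probability by a multiple of an `L¹` norm tending to 0. -/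
theorem ae_tendsto_zero_of_tendsto_eLpNorm_condExp [IsFiniteMeasure μ] (hE : Antitone E)
    (hle : ∀ n, E n ≤ m0) {f : Ω → ℝ}
    (hf : Tendsto (fun n => eLpNorm (μ[f | E n]) 1 μ) atTop (𝓝 0)) :
    ∀ᵐ ω ∂μ, Tendsto (fun n => (μ[f | E n]) ω) atTop (𝓝 0) := by
  have hnull : ∀ c : NNReal, 0 < c →
      ∀ᵐ ω ∂μ, ∃ m, ∀ n, m ≤ n → |(μ[f | E n]) ω| < c := by
    intro c hc
    rw [ae_iff]
    have hbound : ∀ m, c * μ {ω | ¬∃ m, ∀ n, m ≤ n → |(μ[f | E n]) ω| < c}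
        ≤ eLpNorm (μ[f | E m]) 1 μ := by
      intro m
      refine le_trans ?_ (mul_measure_exists_le_abs_condExp_le hE hle f c m)
      gcongr
      intro hω
      push Not at hω
      exact hω m
    have h0 := le_of_tendsto_of_tendsto' tendsto_const_nhds hf hbound
    simpa [hc.ne'] using h0
  have hall := ae_all_iff.2 fun k : ℕ => hnull ((k + 1 : NNReal)⁻¹) (by positivity)
  filter_upwards [hall] with ω hω
  rw [Metric.tendsto_atTop]
  intro δ hδ
  obtain ⟨k, hk⟩ := exists_nat_one_div_lt hδ
  obtain ⟨m, hm⟩ := hω k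
  refine ⟨m, fun n hn => ?_⟩
  rw [Real.dist_eq, sub_zero]
  refine (hm n hn).trans ?_
  simpa using hk

/-- Lévy's downward theorem, almost sure convergence. -/
theorem ae_tendsto_condExp_iInf [IsFiniteMeasure μ] (hE : Antitone E)
    (hle : ∀ n, E n ≤ m0) {f : Ω → ℝ} (hf : Integrable f μ) :
    ∀ᵐ ω ∂μ, Tendsto (fun n => (μ[f | E n]) ω) atTop (𝓝 ((μ[f | ⨅ n, E n]) ω)) := by
  set g := μ[f | ⨅ n, E n]
  have hgi : Integrable g μ := integrable_condExp
  -- The limit `g` is measurable for every `E n`, so subtracting it reduces to limit zero.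
  have hdiff : ∀ n, μ[f - g | E n] =ᵐ[μ] μ[f | E n] - g := by
    intro n
    refine (condExp_sub hf hgi _).trans ?_
    rw [condExp_of_stronglyMeasurable (hle n) (stronglyMeasurable_condExp.mono (iInf_le E n)) hgi]
  have h0 := ae_tendsto_zero_of_tendsto_eLpNorm_condExp hE hle (f := f - g)
    ((tendsto_eLpNorm_condExp_iInf hE hle hf).congr fun n => (eLpNorm_congr_ae (hdiff n)).symm)
  filter_upwards [h0, ae_all_iff.2 hdiff] with ω h1 h2
  simp only [h2, Pi.sub_apply] at h1
  simpa using h1.add_const (g ω)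

end BackwardMartingale

/-! ### Strong law of large numbers for exchangeable measures. -/

section Exchangeable

/-- The sequence `x` with its coordinates permuted by `π`. -/
def permSeq (π : Equiv.Perm ℕ) (x : ℕ → ℝ) : ℕ → ℝ := fun i => x (π i)

theorem measurable_permSeq (π : Equiv.Perm ℕ) : Measurable (permSeq π) :=
  measurable_pi_lambda _ fun i => measurable_pi_apply (π i)

/-- A measure on `ℝ^ℕ` is exchangeable if it is invariant under finite permutations. -/
def ExchangeableMeasure (ν : Measure (ℕ → ℝ)) : Prop :=
  ∀ π : Equiv.Perm ℕ, {i | π i ≠ i}.Finite → ν.map (permSeq π) = ν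

/-- The σ-field of the Borel sets that are invariant under permutations of the first `n`
coordinates. -/
@[reducible] def permInvariantSetsUpTo (n : ℕ) : MeasurableSpace (ℕ → ℝ) where
  MeasurableSet' B := MeasurableSet B ∧
    ∀ π : Equiv.Perm ℕ, (∀ i, n ≤ i → π i = i) → permSeq π ⁻¹' B = B
  measurableSet_empty := ⟨MeasurableSet.empty, fun _ _ => rfl⟩
  measurableSet_compl B hB :=
    ⟨hB.1.compl, fun π hπ => by rw [Set.preimage_compl, hB.2 π hπ]⟩
  measurableSet_iUnion f hf :=
    ⟨MeasurableSet.iUnion fun n => (hf n).1, fun π hπ => by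
      rw [Set.preimage_iUnion]
      exact Set.iUnion_congr fun n => (hf n).2 π hπ⟩

theorem permInvariantSetsUpTo_le (n : ℕ) :
    permInvariantSetsUpTo n ≤ (MeasurableSpace.pi : MeasurableSpace (ℕ → ℝ)) := fun _ hB => hB.1

theorem antitone_permInvariantSetsUpTo : Antitone permInvariantSetsUpTo :=
  fun _ _ hnk _ hB => ⟨hB.1, fun π hπ => hB.2 π fun i hi => hπ i (hnk.trans hi)⟩

theorem iInf_permInvariantSetsUpTo : ⨅ n, permInvariantSetsUpTo (n + 1) = permInvariantSets := by
  ext B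
  rw [MeasurableSpace.measurableSet_iInf]
  constructor
  · intro h
    refine ⟨(h 0).1, fun π hπ => ?_⟩
    obtain ⟨N, hN⟩ := hπ.bddAbove
    refine (h N).2 π fun i hi => ?_
    by_contra hne
    have := hN hne
    omega
  · intro h n
    refine ⟨h.1, fun π hπ => h.2 π ((Set.finite_lt_nat (n + 1)).subset fun i hi => ?_)⟩
    by_contra hlt
    exact hi (hπ i (not_lt.1 hlt))

/-- The average of the first `n` coordinates. -/
noncomputable def coordAverage (n : ℕ) (x : ℕ → ℝ) : ℝ := (n : ℝ)⁻¹ * ∑ i ∈ Finset.range n, x i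

theorem measurable_coordAverage (n : ℕ) : Measurable (coordAverage n) := by
  unfold coordAverage
  fun_prop

theorem coordAverage_permSeq {n : ℕ} {π : Equiv.Perm ℕ} (hπ : ∀ i, n ≤ i → π i = i) (x : ℕ → ℝ) :
    coordAverage n (permSeq π x) = coordAverage n x := by
  unfold coordAverage permSeq
  congr 1
  refine Equiv.Perm.sum_comp π (Finset.range n) x fun i hi => ?_
  by_contra hlt
  exact hi (hπ i (by simpa using hlt))

theorem measurable_coordAverage_permInvariantSetsUpTo (n : ℕ) :
    Measurable[permInvariantSetsUpTo n] (coordAverage n) := by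
  intro s hs
  refine ⟨measurable_coordAverage n hs, fun π hπ => ?_⟩
  ext x
  simp only [Set.mem_preimage, coordAverage_permSeq hπ]

variable {ν : Measure (ℕ → ℝ)}

theorem ExchangeableMeasure.map_permSeq_swap (hν : ExchangeableMeasure ν) (i j : ℕ) :
    MeasurePreserving (permSeq (Equiv.swap i j)) ν ν := by
  refine ⟨measurable_permSeq _, hν _ ((Set.toFinite {i, j}).subset fun k hk => ?_)⟩
  by_contra hne
  simp only [Set.mem_insert_iff, Set.mem_singleton_iff, not_or] at hne
  exact hk (Equiv.swap_apply_of_ne_of_ne hne.1 hne.2)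

theorem ExchangeableMeasure.integrable_coord (hν : ExchangeableMeasure ν)
    (hint : Integrable (fun x => x 0) ν) (i : ℕ) : Integrable (fun x => x i) ν := by
  have := (hν.map_permSeq_swap 0 i).integrable_comp_of_integrable hint
  simpa [Function.comp_def, permSeq] using this

theorem ExchangeableMeasure.setIntegral_coord (hν : ExchangeableMeasure ν) {n i : ℕ} (hi : i < n)
    {B : Set (ℕ → ℝ)} (hB : MeasurableSet[permInvariantSetsUpTo n] B) :
    ∫ x in B, x i ∂ν = ∫ x in B, x 0 ∂ν := by
  have hpre : permSeq (Equiv.swap 0 i) ⁻¹' B = B := hB.2 _ fun k hk =>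
    Equiv.swap_apply_of_ne_of_ne (by omega) (by omega)
  have hmp := (hν.map_permSeq_swap 0 i).restrict_preimage hB.1
  rw [hpre] at hmp
  have := integral_map (μ := ν.restrict B) hmp.measurable.aemeasurable (f := fun x => x 0)
    (by rw [hmp.map_eq]; exact (measurable_pi_apply 0).aestronglyMeasurable)
  rw [hmp.map_eq] at this
  simpa [permSeq] using this.symm

theorem ExchangeableMeasure.integrable_coordAverage (hν : ExchangeableMeasure ν)
    (hint : Integrable (fun x => x 0) ν) (n : ℕ) : Integrable (coordAverage n) ν :=
  (integrable_finsetSum _ fun i _ => hν.integrable_coord hint i).const_mul _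

/-- Over a set invariant under permutations of the first `n + 1` coordinates, these coordinates all
have the same integral, and their average is itself invariant. Hence the averages form a backward
martingale. -/
theorem ExchangeableMeasure.coordAverage_ae_eq_condExp [IsFiniteMeasure ν]
    (hν : ExchangeableMeasure ν) (hint : Integrable (fun x => x 0) ν) (n : ℕ) :
    coordAverage (n + 1) =ᵐ[ν] ν[fun x => x 0 | permInvariantSetsUpTo (n + 1)] := by
  refine ae_eq_condExp_of_forall_setIntegral_eq (permInvariantSetsUpTo_le _) hint
    (fun s _ _ => (hν.integrable_coordAverage hint _).integrableOn) (fun s hs _ => ?_)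
    (measurable_coordAverage_permInvariantSetsUpTo _).aestronglyMeasurable
  unfold coordAverage
  rw [integral_const_mul, integral_finsetSum _ fun i _ => (hν.integrable_coord hint i).integrableOn,
    Finset.sum_congr rfl fun i hi => hν.setIntegral_coord (Finset.mem_range.1 hi) hs]
  rw [Finset.sum_const, Finset.card_range, nsmul_eq_mul, inv_mul_cancel_left₀]
  positivity

/-- Strong law of large numbers for exchangeable measures. -/
theorem ExchangeableMeasure.ae_tendsto_coordAverage [IsFiniteMeasure ν]
    (hν : ExchangeableMeasure ν) (hint : Integrable (fun x => x 0) ν) :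
    ∀ᵐ x ∂ν, Tendsto (fun n => coordAverage n x) atTop
      (𝓝 ((ν[fun x => x 0 | permInvariantSets]) x)) := by
  have h := ae_tendsto_condExp_iInf (E := fun n => permInvariantSetsUpTo (n + 1))
    (fun i j hij => antitone_permInvariantSetsUpTo (Nat.succ_le_succ hij))
    (fun n => permInvariantSetsUpTo_le (n + 1)) hint
  rw [iInf_permInvariantSetsUpTo] at h
  filter_upwards [h, ae_all_iff.2 (hν.coordAverage_ae_eq_condExp hint)] with x hx hA
  rw [← tendsto_add_atTop_iff_nat 1]
  simpa only [hA] using hx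

theorem ExchangeableMeasure.tendsto_eLpNorm_coordAverage [IsFiniteMeasure ν]
    (hν : ExchangeableMeasure ν) (hint : Integrable (fun x => x 0) ν) :
    Tendsto (fun n => eLpNorm (coordAverage n - ν[fun x => x 0 | permInvariantSets]) 1 ν)
      atTop (𝓝 0) := by
  have h := tendsto_eLpNorm_condExp_iInf (E := fun n => permInvariantSetsUpTo (n + 1))
    (fun i j hij => antitone_permInvariantSetsUpTo (Nat.succ_le_succ hij))
    (fun n => permInvariantSetsUpTo_le (n + 1)) hint
  rw [iInf_permInvariantSetsUpTo] at h
  rw [← tendsto_add_atTop_iff_nat 1]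
  refine h.congr fun n => eLpNorm_congr_ae ?_
  exact (hν.coordAverage_ae_eq_condExp hint n).symm.sub (EventuallyEq.refl _ _)

end Exchangeable

/-! ### Laws determined by expected moduli of linear forms. -/

section CramerWold

/-- With `δ = 1 / (n + 1)` the quotient is the ramp equal to 1 up to `a`, to 0 from `a + δ` on, and
linear between. -/
theorem tendsto_abs_sub_abs_div_indicator_Iic (a x : ℝ) :
    Tendsto (fun n : ℕ => (((n : ℝ) + 1)⁻¹ + |(-a - ((n : ℝ) + 1)⁻¹) + x| - |-a + x|)
      / (2 * ((n : ℝ) + 1)⁻¹)) atTop (𝓝 ((Set.Iic a).indicator 1 x)) := by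
  have hpos : ∀ n : ℕ, 0 < ((n : ℝ) + 1)⁻¹ := fun n => by positivity
  by_cases hx : x ≤ a
  · rw [Set.indicator_of_mem (Set.mem_Iic.2 hx)]
    refine tendsto_const_nhds.congr fun n => ?_
    have := hpos n
    rw [abs_of_nonpos (by linarith), abs_of_nonpos (by linarith), eq_div_iff (by positivity)]
    simp only [Pi.one_apply]
    ring
  · rw [Set.indicator_of_notMem (by simpa using hx)]
    push Not at hx
    refine tendsto_const_nhds.congr' ?_
    have hlim : Tendsto (fun n : ℕ => ((n : ℝ) + 1)⁻¹) atTop (𝓝 0) := by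
      simpa using tendsto_one_div_add_atTop_nhds_zero_nat (𝕜 := ℝ)
    filter_upwards [hlim.eventually_lt_const (sub_pos.2 hx)] with n hn
    rw [abs_of_nonneg (by linarith), abs_of_nonneg (by linarith), eq_comm]
    exact div_eq_zero_iff.2 (Or.inl (by ring))

/-- A finite measure `p` on `ℝ` with finite first moment is determined by its mass and the
integrals `∫ |a + x| dp`. -/
theorem eq_of_forall_integral_abs_add_eq {p q : Measure ℝ} [IsFiniteMeasure p]
    [IsFiniteMeasure q] (hp : Integrable (fun x => x) p) (hq : Integrable (fun x => x) q)
    (huniv : p Set.univ = q Set.univ) (h : ∀ a : ℝ, ∫ x, |a + x| ∂p = ∫ x, |a + x| ∂q) :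
    p = q := by
  refine Measure.ext_of_Iic p q fun a => ?_
  have hlim : ∀ r : Measure ℝ, [IsFiniteMeasure r] → Integrable (fun x => x) r →
      Tendsto (fun n : ℕ => (((n : ℝ) + 1)⁻¹ * r.real Set.univ
        + ∫ x, |(-a - ((n : ℝ) + 1)⁻¹) + x| ∂r - ∫ x, |-a + x| ∂r) / (2 * ((n : ℝ) + 1)⁻¹))
        atTop (𝓝 (r.real (Set.Iic a))) := by
    intro r _ hr
    have habs : ∀ b : ℝ, Integrable (fun x => |b + x|) r := fun b =>
      ((integrable_const b).add hr).abs
    have hdom := tendsto_integral_of_dominated_convergence (μ := r)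
      (F := fun n x => (((n : ℝ) + 1)⁻¹ + |(-a - ((n : ℝ) + 1)⁻¹) + x| - |-a + x|)
        / (2 * ((n : ℝ) + 1)⁻¹)) (f := (Set.Iic a).indicator 1) (fun _ => 1)
      (fun n => ((((integrable_const _).add (habs _)).sub (habs _)).div_const _).aestronglyMeasurable)
      (integrable_const _) (fun n => ae_of_all _ fun x => ?_)
      (ae_of_all _ fun x => tendsto_abs_sub_abs_div_indicator_Iic a x)
    · rw [integral_indicator_one measurableSet_Iic] at hdom
      refine hdom.congr fun n => ?_
      have hadd : Integrable (fun x => ((n : ℝ) + 1)⁻¹ + |(-a - ((n : ℝ) + 1)⁻¹) + x|) r :=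
        (integrable_const _).add (habs _)
      rw [integral_div, integral_sub hadd (habs _), integral_add (integrable_const _) (habs _),
        integral_const, smul_eq_mul, mul_comm (r.real Set.univ)]
    · have hpos : 0 < ((n : ℝ) + 1)⁻¹ := by positivity
      have h1 := abs_sub_abs_le_abs_sub ((-a - ((n : ℝ) + 1)⁻¹) + x) (-a + x)
      have h2 := abs_sub_abs_le_abs_sub (-a + x) ((-a - ((n : ℝ) + 1)⁻¹) + x)
      have e1 : ((-a - ((n : ℝ) + 1)⁻¹) + x) - (-a + x) = -((n : ℝ) + 1)⁻¹ := by ring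
      have e2 : (-a + x) - ((-a - ((n : ℝ) + 1)⁻¹) + x) = ((n : ℝ) + 1)⁻¹ := by ring
      rw [e1, abs_neg, abs_of_pos hpos] at h1
      rw [e2, abs_of_pos hpos] at h2
      rw [Real.norm_eq_abs, abs_div, abs_of_pos (a := 2 * _) (by positivity),
        div_le_one (by positivity), abs_le]
      constructor <;> linarith
  have hreal : p.real (Set.Iic a) = q.real (Set.Iic a) := by
    refine tendsto_nhds_unique (hlim p hp) ((hlim q hq).congr fun n => ?_)
    simp only [h, Measure.real, huniv]
  exact (measureReal_eq_measureReal_iff).1 hreal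

/-- Cramér–Wold for sequences: the law of a random sequence is determined by the laws of the
finite linear combinations of its entries. -/
theorem map_eq_of_forall_map_sum_eq {Ω : Type*} [MeasurableSpace Ω] {Q : Measure Ω}
    [IsFiniteMeasure Q] {X Y : ℕ → Ω → ℝ} (hX : ∀ i, Measurable (X i))
    (hY : ∀ i, Measurable (Y i))
    (N : ℕ) (h : ∀ M, N ≤ M → ∀ u : ℕ → ℝ, Q.map (fun ω => ∑ i ∈ Finset.range M, u i * X i ω)
      = Q.map (fun ω => ∑ i ∈ Finset.range M, u i * Y i ω)) :
    Q.map (fun ω i => X i ω) = Q.map (fun ω i => Y i ω) := by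
  rw [map_eq_iff_forall_finset_map_restrict_eq (measurable_pi_lambda _ hX).aemeasurable
    (measurable_pi_lambda _ hY).aemeasurable]
  intro I
  have hXI : Measurable fun ω => I.restrict (X · ω) := measurable_pi_lambda _ fun i => hX i
  have hYI : Measurable fun ω => I.restrict (Y · ω) := measurable_pi_lambda _ fun i => hY i
  refine Measure.ext_of_charFunDual ?_
  funext L
  obtain ⟨M, hM⟩ := I.exists_nat_subset_range
  -- The coefficients of `L` in the standard basis, padded by zeros so that the range can be
  -- enlarged past `N`.
  let u : ℕ → ℝ := fun i => if hi : i ∈ I then L fun j => if ⟨i, hi⟩ = j then 1 else 0 else 0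
  have hL : ∀ x : ℕ → ℝ, L (I.restrict x) = ∑ i ∈ Finset.range (max M N), u i * x i := by
    intro x
    have h1 := LinearMap.pi_apply_eq_sum_univ (L : (I → ℝ) →ₗ[ℝ] ℝ) (I.restrict x)
    rw [← Finset.sum_subset (hM.trans (Finset.range_mono (le_max_left M N)))
      (fun i _ hi => by simp [u, hi]), ← Finset.sum_coe_sort]
    refine h1.trans (Finset.sum_congr rfl fun i _ => ?_)
    simp [u, mul_comm]
  rw [charFunDual_eq_charFun_map_one, charFunDual_eq_charFun_map_one,
    Measure.map_map (by fun_prop) hXI, Measure.map_map (by fun_prop) hYI]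
  simp only [Function.comp_def, hL]
  rw [h _ (le_max_right M N) u]

end CramerWold

/-! ### Exchangeability of the ratios under the reweighted measure. -/

section SizeBias

variable {Ω : Type*} [MeasurableSpace Ω] {μ : Measure Ω}

/-- The measure with density `|f|` with respect to `μ`. -/
noncomputable def sizeBias (μ : Measure Ω) (f : Ω → ℝ) : Measure Ω :=
  μ.withDensity fun ω => (‖f ω‖₊ : ℝ≥0∞)

theorem isFiniteMeasure_sizeBias {f : Ω → ℝ} (hf : Integrable f μ) :
    IsFiniteMeasure (sizeBias μ f) :=
  isFiniteMeasure_withDensity hf.hasFiniteIntegral.ne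

theorem integral_sizeBias {f : Ω → ℝ} (hf : Measurable f) (g : Ω → ℝ) :
    ∫ ω, g ω ∂sizeBias μ f = ∫ ω, |f ω| * g ω ∂μ :=
  integral_withDensity_eq_integral_smul hf.nnnorm g

theorem integrable_sizeBias_iff {f : Ω → ℝ} (hf : Measurable f) {g : Ω → ℝ} :
    Integrable g (sizeBias μ f) ↔ Integrable (fun ω => |f ω| * g ω) μ :=
  integrable_withDensity_iff_integrable_smul hf.nnnorm

theorem ae_of_ae_sizeBias {f : Ω → ℝ} (hf : Measurable f) (hne : ∀ᵐ ω ∂μ, f ω ≠ 0)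
    {P : Ω → Prop} (h : ∀ᵐ ω ∂sizeBias μ f, P ω) : ∀ᵐ ω ∂μ, P ω := by
  refine (withDensity_absolutelyContinuous' (μ := μ) hf.nnnorm.coe_nnreal_ennreal.aemeasurable
    ?_).ae_le h
  filter_upwards [hne] with ω hω
  simpa using hω

variable {ξ : ℕ → Ω → ℝ}

theorem SwapInvariant.integral_abs_sum_perm (hswap : SwapInvariant μ ξ) (d : ℕ)
    (σ : Equiv.Perm (Fin d)) (v : Fin d → ℝ) :
    ∫ ω, |∑ i, v i * ξ (σ i) ω| ∂μ = ∫ ω, |∑ i, v i * ξ i ω| ∂μ :=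
  ((hswap.2 d Fin.val Fin.val_strictMono).2 σ 1).2.2 v

/-- Permuting `ξ₁, …, ξ_N` does not change the expected modulus of a linear combination of
`ξ₀, …, ξ_N`. -/
theorem SwapInvariant.integral_abs_add_sum_perm (hswap : SwapInvariant μ ξ) {N : ℕ}
    {π : Equiv.Perm ℕ} (hπ : ∀ i, N ≤ i → π i = i) (a : ℝ) (u : ℕ → ℝ) :
    ∫ ω, |a * ξ 0 ω + ∑ i ∈ Finset.range N, u i * ξ (π i + 1) ω| ∂μ
      = ∫ ω, |a * ξ 0 ω + ∑ i ∈ Finset.range N, u i * ξ (i + 1) ω| ∂μ := by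
  have hlt : ∀ i, π i < N ↔ i < N := by
    intro i
    constructor <;> intro h <;> by_contra hge <;> push Not at hge
    · rw [hπ i hge] at h
      omega
    · have := π.injective (hπ _ hge)
      omega
  let e : {i // i < N} ≃ Fin N := Fin.equivSubtype.symm
  -- This permutation fixes 0 and acts as `π` on the successors.
  let σ : Equiv.Perm (Fin (N + 1)) :=
    Equiv.Perm.decomposeFin.symm (0, e.permCongr (π.subtypePerm hlt))
  have h := hswap.integral_abs_sum_perm (N + 1) σ (Fin.cons a fun i => u i)
  simpa [Fin.sum_univ_succ, σ, e, Equiv.permCongr_apply, Finset.sum_range] using h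

theorem integral_abs_add_sum_ratio (hmeas : ∀ n, Measurable (ξ n)) (hne : ∀ᵐ ω ∂μ, ξ 0 ω ≠ 0)
    (N : ℕ) (k : ℕ → ℕ) (a : ℝ) (u : ℕ → ℝ) :
    ∫ ω, |a + ∑ i ∈ Finset.range N, u i * (ξ (k i) ω / ξ 0 ω)| ∂sizeBias μ (ξ 0)
      = ∫ ω, |a * ξ 0 ω + ∑ i ∈ Finset.range N, u i * ξ (k i) ω| ∂μ := by
  rw [integral_sizeBias (hmeas 0)]
  refine integral_congr_ae ?_
  filter_upwards [hne] with ω hω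
  rw [← abs_mul, mul_add, Finset.mul_sum]
  congr 2
  · ring
  · refine Finset.sum_congr rfl fun i _ => ?_
    field_simp

theorem integrable_ratio (hmeas : ∀ n, Measurable (ξ n)) (hint : ∀ n, Integrable (ξ n) μ)
    (hne : ∀ᵐ ω ∂μ, ξ 0 ω ≠ 0) (k : ℕ) :
    Integrable (fun ω => ξ k ω / ξ 0 ω) (sizeBias μ (ξ 0)) := by
  rw [integrable_sizeBias_iff (hmeas 0)]
  refine (hint k).abs.congr' (((hmeas 0).abs.mul ((hmeas k).div (hmeas 0))).aestronglyMeasurable) ?_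
  filter_upwards [hne] with ω hω
  simp only [norm_mul, norm_div, Real.norm_eq_abs, abs_abs]
  field_simp

/-- Under the measure `|ξ₀| μ` the ratios `ξ₁/ξ₀, ξ₂/ξ₀, …` are exchangeable. -/
theorem SwapInvariant.exchangeableMeasure_map_ratio (hmeas : ∀ n, Measurable (ξ n))
    (hswap : SwapInvariant μ ξ) (hne : ∀ᵐ ω ∂μ, ξ 0 ω ≠ 0) :
    ExchangeableMeasure ((sizeBias μ (ξ 0)).map fun ω i => ξ (i + 1) ω / ξ 0 ω) := by
  intro π hπ
  have := isFiniteMeasure_sizeBias (hswap.1 0)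
  have hR : ∀ i, Measurable fun ω => ξ (i + 1) ω / ξ 0 ω := fun i => (hmeas _).div (hmeas 0)
  obtain ⟨N, hN⟩ := hπ.bddAbove
  rw [Measure.map_map (measurable_permSeq π) (measurable_pi_lambda _ hR)]
  refine map_eq_of_forall_map_sum_eq (X := fun i ω => ξ (π i + 1) ω / ξ 0 ω)
    (Y := fun i ω => ξ (i + 1) ω / ξ 0 ω) (fun i => hR (π i)) hR (N + 1) fun M hM u => ?_
  have hfix : ∀ i, M ≤ i → π i = i := by
    intro i hi
    by_contra hne
    have := hN hne
    omega
  have hS : ∀ k : ℕ → ℕ, Measurable fun ω => ∑ i ∈ Finset.range M, u i * (ξ (k i) ω / ξ 0 ω) :=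
    fun k => Finset.measurable_fun_sum _ fun i _ => ((hmeas _).div (hmeas 0)).const_mul _
  have hSi : ∀ k : ℕ → ℕ, Integrable (fun ω => ∑ i ∈ Finset.range M, u i * (ξ (k i) ω / ξ 0 ω))
      (sizeBias μ (ξ 0)) := fun k =>
    integrable_finsetSum _ fun i _ => (integrable_ratio hmeas hswap.1 hne (k i)).const_mul _
  have hmap : ∀ k : ℕ → ℕ, ∀ a : ℝ, ∫ x, |a + x| ∂(sizeBias μ (ξ 0)).map
        (fun ω => ∑ i ∈ Finset.range M, u i * (ξ (k i) ω / ξ 0 ω))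
      = ∫ ω, |a * ξ 0 ω + ∑ i ∈ Finset.range M, u i * ξ (k i) ω| ∂μ := fun k a => by
    rw [integral_map (hS k).aemeasurable (by fun_prop), integral_abs_add_sum_ratio hmeas hne]
  refine eq_of_forall_integral_abs_add_eq
    ((integrable_map_measure (by fun_prop) (hS fun i => π i + 1).aemeasurable).2
      (hSi fun i => π i + 1))
    ((integrable_map_measure (by fun_prop) (hS fun i => i + 1).aemeasurable).2
      (hSi fun i => i + 1)) ?_ fun a => ?_
  · rw [Measure.map_apply (hS fun i => π i + 1) MeasurableSet.univ,
      Measure.map_apply (hS fun i => i + 1) MeasurableSet.univ, Set.preimage_univ,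
      Set.preimage_univ]
  · rw [hmap fun i => π i + 1, hmap fun i => i + 1]
    exact hswap.integral_abs_add_sum_perm hfix a u

end SizeBias

/-! ### Passage from the ratios to the signed ratios. -/

section Symmetrization

variable {Ω : Type*} [MeasurableSpace Ω] {μ : Measure Ω} {ξ : ℕ → Ω → ℝ} {ε : Ω → ℝ}

theorem IsRademacher.ae_eq_one_or_neg_one [IsProbabilityMeasure μ] (hrad : IsRademacher μ ε) :
    ∀ᵐ ω ∂μ, ε ω = 1 ∨ ε ω = -1 := by
  have h1 : MeasurableSet {ω | ε ω = 1} := hrad.1 (measurableSet_singleton 1)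
  have h2 : MeasurableSet {ω | ε ω = -1} := hrad.1 (measurableSet_singleton (-1))
  have hdisj : Disjoint {ω | ε ω = 1} {ω | ε ω = -1} := by
    refine Set.disjoint_left.2 fun ω (h : ε ω = 1) (h' : ε ω = -1) => ?_
    norm_num [h] at h'
  have hun : μ ({ω | ε ω = 1} ∪ {ω | ε ω = -1}) = 1 := by
    rw [measure_union hdisj h2, hrad.2.1, hrad.2.2, ENNReal.add_halves]
  exact (prob_compl_eq_zero_iff (h1.union h2)).2 hun

theorem measurable_signedRatios (hmeas : ∀ n, Measurable (ξ n)) (hε : Measurable ε) :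
    Measurable (signedRatios ξ ε) :=
  measurable_pi_lambda _ fun n => hε.mul ((hmeas (n + 1)).div (hmeas 0).abs)

/-- The density is a function of `ξ` alone, so reweighting does not disturb the independence of `ε`.
-/
theorem sizeBias_inter_of_indepFun (hmeas : ∀ n, Measurable (ξ n)) (hε : Measurable ε)
    (hindep : IndepFun ε (fun ω n => ξ n ω) μ) (s : ℝ) {C : Set (ℕ → ℝ)} (hC : MeasurableSet C) :
    sizeBias μ (ξ 0) ({ω | ε ω = s} ∩ {ω | (fun n => ξ n ω) ∈ C})
      = μ {ω | ε ω = s} * sizeBias μ (ξ 0) {ω | (fun n => ξ n ω) ∈ C} := by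
  have hξ : Measurable fun ω n => ξ n ω := measurable_pi_lambda _ hmeas
  have hs : MeasurableSet {ω | ε ω = s} := hε (measurableSet_singleton s)
  have hCm : MeasurableSet {ω | (fun n => ξ n ω) ∈ C} := hξ hC
  let f : ℝ → ℝ≥0∞ := ({s} : Set ℝ).indicator 1
  let g : (ℕ → ℝ) → ℝ≥0∞ := C.indicator fun x => (‖x 0‖₊ : ℝ≥0∞)
  have hf : Measurable f := measurable_one.indicator (measurableSet_singleton s)
  have hg : Measurable g :=
    (measurable_pi_apply 0).nnnorm.coe_nnreal_ennreal.indicator hC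
  have h := lintegral_mul_eq_lintegral_mul_lintegral_of_indepFun (hf.comp hε) (hg.comp hξ)
    (hindep.comp hf hg)
  have hfs : f ∘ ε = {ω | ε ω = s}.indicator 1 := rfl
  have hgs : (g ∘ fun ω n => ξ n ω)
      = {ω | (fun n => ξ n ω) ∈ C}.indicator fun ω => (‖ξ 0 ω‖₊ : ℝ≥0∞) := rfl
  rw [hfs, hgs, lintegral_indicator_one hs, lintegral_indicator hCm] at h
  rw [sizeBias, withDensity_apply _ hCm, withDensity_apply _ (hs.inter hCm), ← h,
    ← lintegral_indicator (hs.inter hCm)]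
  refine lintegral_congr fun ω => ?_
  by_cases h1 : ω ∈ {ω | ε ω = s} <;> by_cases h2 : ω ∈ {ω | (fun n => ξ n ω) ∈ C} <;>
    simp only [Pi.mul_apply, Set.indicator, Set.mem_inter_iff, h1, h2, if_true, if_false, and_self,
      and_true, and_false, Pi.one_apply, one_mul, mul_zero, zero_mul]

theorem sizeBias_absolutelyContinuous (f : Ω → ℝ) : sizeBias μ f ≪ μ :=
  withDensity_absolutelyContinuous _ _

/-- Almost surely `ε / |ξ 0|` is `ε sgn(ξ 0)` divided by `ξ 0`, and `ε sgn(ξ 0)` is again a fair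
sign independent of `ξ`. Concretely, the events are split by the sign of `ξ 0`, which exchanges the
two halves of the mixture where it is negative. -/
theorem sizeBias_signedRatios_preimage [IsProbabilityMeasure μ] (hmeas : ∀ n, Measurable (ξ n))
    (hrad : IsRademacher μ ε) (hindep : IndepFun ε (fun ω n => ξ n ω) μ)
    {B : Set (ℕ → ℝ)} (hB : MeasurableSet B) :
    sizeBias μ (ξ 0) (signedRatios ξ ε ⁻¹' B)
      = 1 / 2 * (sizeBias μ (ξ 0) {ω | (fun n => ξ (n + 1) ω / ξ 0 ω) ∈ B}
        + sizeBias μ (ξ 0) {ω | (fun n => -(ξ (n + 1) ω / ξ 0 ω)) ∈ B}) := by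
  set Q := sizeBias μ (ξ 0)
  have hξ : Measurable fun ω n => ξ n ω := measurable_pi_lambda _ hmeas
  let T : (ℕ → ℝ) → ℕ → ℝ := fun x n => x (n + 1) / |x 0|
  have hT : Measurable T := measurable_pi_lambda _ fun n => by fun_prop
  have hCp : MeasurableSet {x : ℕ → ℝ | T x ∈ B} := hT hB
  have hCn : MeasurableSet {x : ℕ → ℝ | -T x ∈ B} := hT.neg hB
  have hpos : MeasurableSet {ω | 0 < ξ 0 ω} := measurableSet_lt measurable_const (hmeas 0)
  have hsplit : Q (signedRatios ξ ε ⁻¹' B)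
      = Q ({ω | ε ω = 1} ∩ {ω | T (fun n => ξ n ω) ∈ B})
        + Q ({ω | ε ω = -1} ∩ {ω | -T (fun n => ξ n ω) ∈ B}) := by
    have hm : MeasurableSet ({ω | ε ω = -1} ∩ {ω | -T (fun n => ξ n ω) ∈ B}) :=
      (hrad.1 (measurableSet_singleton (-1))).inter (hξ hCn)
    rw [← measure_union _ hm]
    · refine measure_congr ?_
      filter_upwards [(sizeBias_absolutelyContinuous (ξ 0)).ae_le hrad.ae_eq_one_or_neg_one]
        with ω hω
      refine propext ?_
      change signedRatios ξ ε ω ∈ B ↔ (ε ω = 1 ∧ T (fun n => ξ n ω) ∈ B) ∨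
        (ε ω = -1 ∧ -T (fun n => ξ n ω) ∈ B)
      rcases hω with h | h
      · have : signedRatios ξ ε ω = T fun n => ξ n ω := by
          funext n
          simp [signedRatios, T, h]
        rw [this]
        norm_num [h]
      · have : signedRatios ξ ε ω = -T fun n => ξ n ω := by
          funext n
          simp [signedRatios, T, h]
        rw [this]
        norm_num [h]
    · refine Set.disjoint_left.2 fun ω h h' => ?_
      have h1 : ε ω = 1 := h.1
      have h2 : ε ω = -1 := h'.1
      norm_num [h1] at h2
  have hTR : ∀ ω, 0 < ξ 0 ω → (T fun n => ξ n ω) = fun n => ξ (n + 1) ω / ξ 0 ω := by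
    intro ω h
    funext n
    simp [T, abs_of_pos h]
  have hTR' : ∀ ω, ¬0 < ξ 0 ω → (T fun n => ξ n ω) = fun n => -(ξ (n + 1) ω / ξ 0 ω) := by
    intro ω h
    funext n
    simp [T, abs_of_nonpos (not_lt.1 h), div_neg]
  have e1 := sizeBias_inter_of_indepFun hmeas hrad.1 hindep 1 hCp
  have e2 := sizeBias_inter_of_indepFun hmeas hrad.1 hindep (-1) hCn
  rw [hrad.2.1] at e1
  rw [hrad.2.2] at e2
  simp only [Set.mem_ofPred_eq] at e1 e2
  rw [hsplit, e1, e2, ← mul_add]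
  congr 1
  rw [← measure_inter_add_sdiff {ω | T (fun n => ξ n ω) ∈ B} hpos,
    ← measure_inter_add_sdiff {ω | -T (fun n => ξ n ω) ∈ B} hpos,
    ← measure_inter_add_sdiff {ω | (fun n => ξ (n + 1) ω / ξ 0 ω) ∈ B} hpos,
    ← measure_inter_add_sdiff {ω | (fun n => -(ξ (n + 1) ω / ξ 0 ω)) ∈ B} hpos]
  have s1 : {ω | T (fun n => ξ n ω) ∈ B} ∩ {ω | 0 < ξ 0 ω}
      = {ω | (fun n => ξ (n + 1) ω / ξ 0 ω) ∈ B} ∩ {ω | 0 < ξ 0 ω} := by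
    ext ω
    refine and_congr_left fun h => ?_
    simp only [Set.mem_ofPred_eq, hTR ω h]
  have s2 : {ω | -T (fun n => ξ n ω) ∈ B} ∩ {ω | 0 < ξ 0 ω}
      = {ω | (fun n => -(ξ (n + 1) ω / ξ 0 ω)) ∈ B} ∩ {ω | 0 < ξ 0 ω} := by
    ext ω
    refine and_congr_left fun h => ?_
    simp only [Set.mem_ofPred_eq, hTR ω h, Pi.neg_def]
  have s3 : {ω | T (fun n => ξ n ω) ∈ B} \ {ω | 0 < ξ 0 ω}
      = {ω | (fun n => -(ξ (n + 1) ω / ξ 0 ω)) ∈ B} \ {ω | 0 < ξ 0 ω} := by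
    ext ω
    refine and_congr_left fun h => ?_
    simp only [Set.mem_ofPred_eq, hTR' ω h]
  have s4 : {ω | -T (fun n => ξ n ω) ∈ B} \ {ω | 0 < ξ 0 ω}
      = {ω | (fun n => ξ (n + 1) ω / ξ 0 ω) ∈ B} \ {ω | 0 < ξ 0 ω} := by
    ext ω
    refine and_congr_left fun h => ?_
    simp only [Set.mem_ofPred_eq, hTR' ω h, Pi.neg_def, neg_neg]
  rw [s1, s2, s3, s4]
  ac_rfl

/-- Under the measure `|ξ₀| μ` the sequence of signed ratios is exchangeable. -/
theorem SwapInvariant.exchangeableMeasure_map_signedRatios [IsProbabilityMeasure μ]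
    (hmeas : ∀ n, Measurable (ξ n)) (hswap : SwapInvariant μ ξ) (hne : ∀ᵐ ω ∂μ, ξ 0 ω ≠ 0)
    (hrad : IsRademacher μ ε) (hindep : IndepFun ε (fun ω n => ξ n ω) μ) :
    ExchangeableMeasure ((sizeBias μ (ξ 0)).map (signedRatios ξ ε)) := by
  intro π hπ
  have hX := measurable_signedRatios hmeas hrad.1
  have hR : Measurable fun ω i => ξ (i + 1) ω / ξ 0 ω :=
    measurable_pi_lambda _ fun i => (hmeas _).div (hmeas 0)
  have hexch : ∀ C : Set (ℕ → ℝ), MeasurableSet C →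
      sizeBias μ (ξ 0) {ω | permSeq π (fun i => ξ (i + 1) ω / ξ 0 ω) ∈ C}
        = sizeBias μ (ξ 0) {ω | (fun i => ξ (i + 1) ω / ξ 0 ω) ∈ C} := by
    intro C hC
    have h := congrArg (fun ρ : Measure (ℕ → ℝ) => ρ C)
      (hswap.exchangeableMeasure_map_ratio hmeas hne π hπ)
    simp only [Measure.map_map (measurable_permSeq π) hR] at h
    rwa [Measure.map_apply ((measurable_permSeq π).comp hR) hC, Measure.map_apply hR hC] at h
  ext B hB
  have hBπ : MeasurableSet (permSeq π ⁻¹' B) := measurable_permSeq π hB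
  rw [Measure.map_apply (measurable_permSeq π) hB, Measure.map_apply hX hBπ,
    Measure.map_apply hX hB, sizeBias_signedRatios_preimage hmeas hrad hindep hBπ,
    sizeBias_signedRatios_preimage hmeas hrad hindep hB]
  congr 2
  · exact hexch B hB
  -- Negation commutes with permuting coordinates.
  · exact hexch {x | -x ∈ B} (measurable_neg hB)

end Symmetrization

/-! ### Averages of `ξ` in terms of the signed ratios. -/

section SignedRatios

variable {Ω : Type*} {ξ : ℕ → Ω → ℝ} {ε : Ω → ℝ}

theorem abs_mul_signedRatios_zero {ω : Ω} (h : ξ 0 ω ≠ 0) :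
    |ξ 0 ω| * signedRatios ξ ε ω 0 = ε ω * ξ 1 ω := by
  have := abs_ne_zero.2 h
  simp only [signedRatios, zero_add]
  field_simp

/-- Since `ε² = 1`, each later entry of `ξ` is `ε |ξ 0|` times a signed ratio; only `ξ 0` stands
apart, with weight `1 / (n + 1)`. -/
theorem seqAverage_succ_eq {ω : Ω} (h : ξ 0 ω ≠ 0) (hε : ε ω = 1 ∨ ε ω = -1) (n : ℕ) :
    seqAverage ξ (n + 1) ω = ((n : ℝ) + 1)⁻¹ * ξ 0 ω
      + (n * ((n : ℝ) + 1)⁻¹) * (ε ω * (|ξ 0 ω| * coordAverage n (signedRatios ξ ε ω))) := by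
  have h0 := abs_ne_zero.2 h
  have hsq : ε ω * ε ω = 1 := by rcases hε with h | h <;> rw [h] <;> norm_num
  have hterm : ∀ i, ε ω * (|ξ 0 ω| * signedRatios ξ ε ω i) = ξ (i + 1) ω := by
    intro i
    simp only [signedRatios]
    calc ε ω * (|ξ 0 ω| * (ε ω * (ξ (i + 1) ω / |ξ 0 ω|)))
        = (ε ω * ε ω) * (|ξ 0 ω| * (ξ (i + 1) ω / |ξ 0 ω|)) := by ring
      _ = ξ (i + 1) ω := by rw [hsq, one_mul, mul_div_cancel₀ _ h0]
  have hsum : ε ω * (|ξ 0 ω| * ∑ i ∈ Finset.range n, signedRatios ξ ε ω i)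
      = ∑ i ∈ Finset.range n, ξ (i + 1) ω := by
    rw [Finset.mul_sum, Finset.mul_sum]
    exact Finset.sum_congr rfl fun i _ => hterm i
  rw [seqAverage, coordAverage, Finset.sum_range_succ', ← hsum]
  rcases Nat.eq_zero_or_pos n with rfl | hn
  · simp
  · have : (n : ℝ) ≠ 0 := by positivity
    push_cast
    field_simp
    ring

end SignedRatios

/-! ### Transfer between `μ` and the reweighted law; Bayes' formula. -/

section Limit

variable {Ω : Type*} [mΩ : MeasurableSpace Ω] {μ : Measure Ω}

/-- The set where the conditional expectation is nonpositive belongs to `m`, so `f` has nonpositive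
integral there; as `f > 0` a.e., the set is null. -/
theorem condExp_pos_of_ae_pos [IsFiniteMeasure μ] {m : MeasurableSpace Ω} (hm : m ≤ mΩ)
    {f : Ω → ℝ} (hf : Integrable f μ) (hpos : ∀ᵐ ω ∂μ, 0 < f ω) :
    ∀ᵐ ω ∂μ, 0 < (μ[f | m]) ω := by
  have hs : MeasurableSet[m] {ω | (μ[f | m]) ω ≤ 0} :=
    @measurableSet_le _ _ _ _ _ m _ _ _ _ _ stronglyMeasurable_condExp.measurable measurable_const
  have hle : ∫ ω in {ω | (μ[f | m]) ω ≤ 0}, f ω ∂μ ≤ 0 := by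
    rw [← setIntegral_condExp hm hf hs]
    exact setIntegral_nonpos (hm _ hs) fun ω hω => hω
  have h0 : f =ᵐ[μ.restrict {ω | (μ[f | m]) ω ≤ 0}] 0 := by
    refine (setIntegral_eq_zero_iff_of_nonneg_ae (ae_restrict_of_ae ?_) hf.integrableOn).1
      (le_antisymm hle (integral_nonneg_of_ae (ae_restrict_of_ae ?_)))
    all_goals filter_upwards [hpos] with ω hω using hω.le
  have h1 := (ae_restrict_iff' (hm _ hs)).1 h0
  filter_upwards [h1, hpos] with ω h hω
  by_contra hneg
  have := h (not_lt.1 hneg)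
  simp only [Pi.zero_apply] at this
  exact hω.ne' this

theorem eLpNorm_one_comp_sizeBias {f : Ω → ℝ} (hf : Measurable f) {X : Ω → ℕ → ℝ}
    (hX : Measurable X) {F : (ℕ → ℝ) → ℝ} (hF : Measurable F) :
    eLpNorm (fun ω => |f ω| * F (X ω)) 1 μ = eLpNorm F 1 ((sizeBias μ f).map X) := by
  rw [eLpNorm_one_eq_lintegral_enorm, eLpNorm_one_eq_lintegral_enorm,
    lintegral_map hF.enorm hX, sizeBias,
    lintegral_withDensity_eq_lintegral_mul _ hf.nnnorm.coe_nnreal_ennreal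
      (g := fun ω => ‖F (X ω)‖ₑ) (hF.enorm.comp hX)]
  refine lintegral_congr fun ω => ?_
  simp only [Pi.mul_apply, enorm_mul, Real.enorm_abs]
  rfl

theorem setIntegral_comp_sizeBias {f : Ω → ℝ} (hf : Measurable f) {X : Ω → ℕ → ℝ}
    (hX : Measurable X) {F : (ℕ → ℝ) → ℝ} (hF : Measurable F) {B : Set (ℕ → ℝ)}
    (hB : MeasurableSet B) :
    ∫ ω in X ⁻¹' B, |f ω| * F (X ω) ∂μ = ∫ x in B, F x ∂(sizeBias μ f).map X := by
  rw [setIntegral_map hB hF.aestronglyMeasurable hX.aemeasurable, sizeBias,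
    setIntegral_withDensity_eq_setIntegral_smul hf.nnnorm _ (hX hB)]
  rfl

theorem integrable_comp_sizeBias {f : Ω → ℝ} (hf : Measurable f) {X : Ω → ℕ → ℝ}
    (hX : Measurable X) {F : (ℕ → ℝ) → ℝ} (hF : Measurable F) :
    Integrable (fun ω => |f ω| * F (X ω)) μ ↔ Integrable F ((sizeBias μ f).map X) := by
  rw [integrable_map_measure hF.aestronglyMeasurable hX.aemeasurable, integrable_sizeBias_iff hf]
  rfl

theorem permInvariantSets_le : permInvariantSets ≤ (MeasurableSpace.pi : MeasurableSpace (ℕ → ℝ)) :=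
  fun _ hB => hB.1

/-- Bayes' formula for the exchangeable σ-field: a conditional expectation under the law of `X`
with respect to `|f| μ`, expressed by conditional expectations under `μ`. -/
theorem condExp_permInvariantField_eq_mul_condExp [IsProbabilityMeasure μ] {f : Ω → ℝ}
    (hf : Measurable f)
    (hfi : Integrable f μ) {X : Ω → ℕ → ℝ} (hX : Measurable X) {F : (ℕ → ℝ) → ℝ}
    (hF : Measurable F) (hFi : Integrable F ((sizeBias μ f).map X)) :
    μ[fun ω => |f ω| * F (X ω) | permInvariantField X]
      =ᵐ[μ] fun ω => (((sizeBias μ f).map X)[F | permInvariantSets]) (X ω)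
        * (μ[fun ω => |f ω| | permInvariantField X]) ω := by
  have := isFiniteMeasure_sizeBias hfi
  set Y := ((sizeBias μ f).map X)[F | permInvariantSets]
  have hle : permInvariantField X ≤ mΩ := permInvariantField_le hX
  have hYm : StronglyMeasurable[permInvariantSets] Y := stronglyMeasurable_condExp
  have hY : Measurable Y := hYm.measurable.mono permInvariantSets_le le_rfl
  have hYi : Integrable (fun ω => |f ω| * Y (X ω)) μ :=
    (integrable_comp_sizeBias hf hX hY).2 integrable_condExp
  have hYX : StronglyMeasurable[permInvariantField X] fun ω => Y (X ω) :=
    hYm.comp_measurable (comap_measurable X)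
  have hpull : μ[(fun ω => Y (X ω)) * (fun ω => |f ω|) | permInvariantField X]
      =ᵐ[μ] (fun ω => Y (X ω)) * μ[fun ω => |f ω| | permInvariantField X] :=
    condExp_mul_of_stronglyMeasurable_left hYX (hYi.congr (ae_of_all _ fun ω => mul_comm _ _))
      hfi.abs
  refine EventuallyEq.trans ?_ hpull
  refine (ae_eq_condExp_of_forall_setIntegral_eq hle
    ((integrable_comp_sizeBias hf hX hF).2 hFi) (fun _ _ _ => integrable_condExp.integrableOn)
    ?_ stronglyMeasurable_condExp.aestronglyMeasurable).symm
  -- On `X ⁻¹' B` with `B` invariant, both sides become integrals over `B` under the reweighted law,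
  -- where `Y` may replace `F`.
  rintro _ ⟨B, hB, rfl⟩ -
  have hYi' : Integrable ((fun ω => Y (X ω)) * fun ω => |f ω|) μ :=
    hYi.congr (ae_of_all _ fun ω => mul_comm _ _)
  rw [setIntegral_condExp hle hYi' ⟨B, hB, rfl⟩,
    setIntegral_comp_sizeBias hf hX hF hB.1, ← setIntegral_condExp permInvariantSets_le hFi hB,
    ← setIntegral_comp_sizeBias hf hX hY hB.1]
  simp only [Pi.mul_apply, mul_comm]

end Limit

/-! ### The ergodic theorem. -/

theorem mainTheorem8 {Ω : Type*} [MeasurableSpace Ω] (μ : Measure Ω) [IsProbabilityMeasure μ]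
    (ξ : ℕ → Ω → ℝ) (hmeas : ∀ n, Measurable (ξ n)) (hswap : SwapInvariant μ ξ)
    (hne : ∀ᵐ ω ∂μ, ξ 0 ω ≠ 0)
    (ε : Ω → ℝ) (hrad : IsRademacher μ ε) (hindep : IndepFun ε (fun ω n => ξ n ω) μ) :
    (∀ᵐ ω ∂μ, 0 < (μ[fun ω' => |ξ 0 ω'| | permInvariantField (signedRatios ξ ε)]) ω) ∧
      (∀ᵐ ω ∂μ, Tendsto (fun n => seqAverage ξ n ω) atTop (𝓝 (ergodicLimit μ ξ ε ω))) ∧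
      Integrable (ergodicLimit μ ξ ε) μ ∧
      Tendsto (fun n => eLpNorm (seqAverage ξ n - ergodicLimit μ ξ ε) 1 μ) atTop (𝓝 0) := by
  have hfin := isFiniteMeasure_sizeBias (hswap.1 0)
  have hX : Measurable (signedRatios ξ ε) := measurable_signedRatios hmeas hrad.1
  have hε := hrad.ae_eq_one_or_neg_one
  set X := signedRatios ξ ε with hXdef
  set ν := (sizeBias μ (ξ 0)).map X
  have hexch : ExchangeableMeasure ν :=
    hswap.exchangeableMeasure_map_signedRatios hmeas hne hrad hindep
  have hx0 : Integrable (fun x : ℕ → ℝ => x 0) ν := by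
    rw [← integrable_comp_sizeBias (hmeas 0) hX (measurable_pi_apply 0)]
    refine (hswap.1 1).congr' ((hmeas 0).abs.mul
      ((measurable_pi_apply 0).comp hX)).aestronglyMeasurable ?_
    filter_upwards [hne, hε] with ω h0 h1
    rw [abs_mul_signedRatios_zero h0, norm_mul]
    rcases h1 with h | h <;> simp [h]
  set Y := ν[fun x => x 0 | permInvariantSets]
  have hY : Measurable Y := stronglyMeasurable_condExp.measurable.mono permInvariantSets_le le_rfl
  have hpos : ∀ᵐ ω ∂μ, 0 < (μ[fun ω' => |ξ 0 ω'| | permInvariantField X]) ω :=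
    condExp_pos_of_ae_pos (permInvariantField_le hX) (hswap.1 0).abs
      (hne.mono fun ω h => abs_pos.2 h)
  -- Bayes' formula for the zeroth coordinate, because `|ξ 0|` times the first signed ratio is `ε ξ
  -- 1`.
  have hbayes : μ[fun ω => ε ω * ξ 1 ω | permInvariantField X]
      =ᵐ[μ] fun ω => Y (X ω) * (μ[fun ω => |ξ 0 ω| | permInvariantField X]) ω := by
    refine (condExp_congr_ae ?_).trans
      (condExp_permInvariantField_eq_mul_condExp (hmeas 0) (hswap.1 0) hX
      (measurable_pi_apply 0) hx0)
    filter_upwards [hne] with ω h0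
    exact (abs_mul_signedRatios_zero h0).symm
  have hlim : ergodicLimit μ ξ ε =ᵐ[μ] fun ω => ε ω * (|ξ 0 ω| * Y (X ω)) := by
    filter_upwards [hpos, hbayes, hε] with ω h1 h2 h3
    rw [ergodicLimit, ← hXdef, h2]
    rcases h3 with h | h <;> rw [h] <;> field_simp
  have hZi : Integrable (fun ω => |ξ 0 ω| * Y (X ω)) μ :=
    (integrable_comp_sizeBias (hmeas 0) hX hY).2 integrable_condExp
  have hLi : Integrable (ergodicLimit μ ξ ε) μ := by
    refine Integrable.congr (hZi.congr' (g := fun ω => ε ω * (|ξ 0 ω| * Y (X ω)))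
      (hrad.1.mul ((hmeas 0).abs.mul (hY.comp hX))).aestronglyMeasurable ?_) hlim.symm
    filter_upwards [hε] with ω h1
    rw [norm_mul (ε ω)]
    rcases h1 with h | h <;> simp [h]
  have hinv : Tendsto (fun n : ℕ => ((n : ℝ) + 1)⁻¹) atTop (𝓝 0) := by
    simpa using tendsto_one_div_add_atTop_nhds_zero_nat (𝕜 := ℝ)
  refine ⟨hpos, ?_, hLi, ?_⟩
  · have hA : ∀ᵐ ω ∂μ, Tendsto (fun n => coordAverage n (X ω)) atTop (𝓝 (Y (X ω))) :=
      ae_of_ae_sizeBias (hmeas 0) hne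
        (ae_of_ae_map hX.aemeasurable (hexch.ae_tendsto_coordAverage hx0))
    filter_upwards [hA, hlim, hne, hε] with ω h1 h2 h3 h4
    rw [← tendsto_add_atTop_iff_nat 1, h2]
    simp only [seqAverage_succ_eq h3 h4]
    have hratio : Tendsto (fun n : ℕ => (n : ℝ) * ((n : ℝ) + 1)⁻¹) atTop (𝓝 1) := by
      simpa [div_eq_mul_inv] using tendsto_natCast_div_add_atTop (1 : ℝ)
    simpa using (hinv.mul_const (ξ 0 ω)).add
      (hratio.mul ((h1.const_mul |ξ 0 ω|).const_mul (ε ω)))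
  · rw [← tendsto_add_atTop_iff_nat 1]
    have hbound : ∀ n : ℕ, eLpNorm (seqAverage ξ (n + 1) - ergodicLimit μ ξ ε) 1 μ
        ≤ ENNReal.ofReal ((n : ℝ) + 1)⁻¹ * eLpNorm (ξ 0 - ergodicLimit μ ξ ε) 1 μ
          + eLpNorm (coordAverage n - Y) 1 ν := by
      intro n
      have hAY : Measurable (coordAverage n - Y) := (measurable_coordAverage n).sub hY
      -- The weights `1 / (n + 1)` and `n / (n + 1)` sum to 1, so the limit can be subtracted from
      -- each term separately.
      have hdecomp : seqAverage ξ (n + 1) - ergodicLimit μ ξ ε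
          =ᵐ[μ] ((n : ℝ) + 1)⁻¹ • (ξ 0 - ergodicLimit μ ξ ε)
            + fun ω => (n * ((n : ℝ) + 1)⁻¹ * ε ω) * (|ξ 0 ω| * (coordAverage n - Y) (X ω)) := by
        filter_upwards [hlim, hne, hε] with ω h2 h3 h4
        simp only [Pi.add_apply, Pi.sub_apply, Pi.smul_apply, smul_eq_mul,
          seqAverage_succ_eq h3 h4, h2]
        field_simp
        ring
      rw [eLpNorm_congr_ae hdecomp, ← eLpNorm_one_comp_sizeBias (hmeas 0) hX hAY]
      refine (eLpNorm_add_le (((hswap.1 0).sub hLi).aestronglyMeasurable.const_smul _)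
        (((hrad.1.const_mul _).mul
          ((hmeas 0).abs.mul (hAY.comp hX))).aestronglyMeasurable) le_rfl).trans ?_
      refine add_le_add ?_ (eLpNorm_mono_ae ?_)
      · rw [eLpNorm_const_smul, Real.enorm_of_nonneg (by positivity)]
      · filter_upwards [hε] with ω h1
        change ‖(n * ((n : ℝ) + 1)⁻¹ * ε ω) * (|ξ 0 ω| * (coordAverage n - Y) (X ω))‖ ≤ _
        rw [norm_mul (_ * _)]
        refine mul_le_of_le_one_left (norm_nonneg _) ?_
        have hle : (n : ℝ) * ((n : ℝ) + 1)⁻¹ ≤ 1 := by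
          rw [← div_eq_mul_inv, div_le_one (by positivity)]
          linarith
        have hnn : 0 ≤ (n : ℝ) * ((n : ℝ) + 1)⁻¹ := by positivity
        rw [norm_mul, Real.norm_of_nonneg hnn]
        rcases h1 with h | h <;> simpa [h] using hle
    refine tendsto_of_tendsto_of_tendsto_of_le_of_le tendsto_const_nhds ?_ (fun _ => zero_le)
      hbound
    have h1 : Tendsto (fun n : ℕ => ENNReal.ofReal ((n : ℝ) + 1)⁻¹
        * eLpNorm (ξ 0 - ergodicLimit μ ξ ε) 1 μ) atTop (𝓝 0) := by
      have := ENNReal.Tendsto.mul_const (b := eLpNorm (ξ 0 - ergodicLimit μ ξ ε) 1 μ)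
        (ENNReal.tendsto_ofReal hinv)
        (Or.inr (memLp_one_iff_integrable.2 ((hswap.1 0).sub hLi)).eLpNorm_ne_top)
      simpa using this
    simpa using h1.add (hexch.tendsto_eLpNorm_coordAverage hx0)
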